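/- Let $r_3(l,l,l)$ be the $3$-colour, $3$-uniform hypergraph Ramsey number, that is, the smallest natural number $n$ such that every colouring of the $3$-element subsets of an $n$-element set with three colours admits an $l$-element subset all of whose $3$-element subsets receive the same colour. Then there exist an absolute constant $c > 0$ and a natural number $l_0$ such that, for all natural numbers $l \ge l_0$, \[ r_3(l,l,l) \;\ge\; 2^{\,l^{\,c \log_2 \log_2 l}} . \] -/

import Mathlib

/-- A colouring, with colours `Fin q`, of the edges of the complete `k`-uniform hypergraph on the
vertex set `Fin n`, that is, of the `k`-element subsets of `Fin n`. -/
abbrev EdgeColouring (k q n : ℕ) : Type :=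
  {e : Finset (Fin n) // e.card = k} → Fin q

/-- The vertex set `S` spans a monochromatic complete `k`-uniform hypergraph in colour `i`. -/
def IsMonochromatic {k q n : ℕ} (χ : EdgeColouring k q n) (i : Fin q)
    (S : Finset (Fin n)) : Prop :=
  ∀ e : {e : Finset (Fin n) // e.card = k}, e.1 ⊆ S → χ e = i

/-- In every `q`-colouring of the complete `k`-uniform hypergraph on `n` vertices there is, for
some colour `i`, a monochromatic complete `k`-uniform hypergraph on `l i` vertices in colour `i`. -/
def RamseyProperty (k : ℕ) {q : ℕ} (l : Fin q → ℕ) (n : ℕ) : Prop :=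
  ∀ χ : EdgeColouring k q n, ∃ (i : Fin q) (S : Finset (Fin n)),
    S.card = l i ∧ IsMonochromatic χ i S

/-- The hypergraph Ramsey number `r_k(l_1, …, l_q)`: the smallest `n` with the Ramsey property.
(As a natural number; it would be `0` if no such `n` existed, so a positive lower bound for it
includes the existence of such an `n`.) -/
noncomputable def ramseyNumber (k : ℕ) {q : ℕ} (l : Fin q → ℕ) : ℕ :=
  sInf {n : ℕ | RamseyProperty k l n}

/-! The proof is a stepping-up argument with a very unbalanced random graph. Put N = 2^(t^2) with t
of order log l, and make each pair of levels below N a non-edge of R with probability 2^(-t). Union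
bounds leave no independent set of size 4t and no clique of size 2^(3t)
(`exists_unbalanced_ramsey_relation`).

Colour a triple x < y < z below 2^N through the top differing bits of x, y and of y, z: colour 2 if
R fails for them, otherwise 0 or 1 as they increase or decrease. A set in colour 0 or 1 yields an
R-clique with one element fewer. A set in colour 2 yields only an independent set of logarithmic
size, a branch of its binary tree (`exists_branch`); this loss is why independent sets must be so
small. With 2^(4t) ≤ l every colour is excluded, so the Ramsey number exceeds 2^N.

The finite Ramsey theorem is needed only because `sInf` of the empty set is 0. -/

/-! ### The finite Ramsey theorem -/

/-- A set on which the colour of an edge depends only on its least vertex. -/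
theorem exists_minHomogeneous_of_ramsey {κ : Type} {k : ℕ}
    (hk : ∀ m : ℕ, ∃ n : ℕ, ∀ (α : Type) [LinearOrder α] (f : Finset α → κ) (V : Finset α),
      n ≤ V.card → ∃ S ⊆ V, S.card = m ∧ ∃ c, ∀ e ⊆ S, e.card = k → f e = c) (m : ℕ) :
    ∃ n : ℕ, ∀ (α : Type) [LinearOrder α] (f : Finset α → κ) (V : Finset α), n ≤ V.card →
      ∃ S ⊆ V, S.card = m ∧ ∀ v ∈ S, ∃ c, ∀ e ⊆ S, e.card = k → (∀ x ∈ e, v < x) →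
        f (insert v e) = c := by
  induction m with
  | zero => exact ⟨0, fun α _ f V _ => ⟨∅, by simp⟩⟩
  | succ m ih =>
    obtain ⟨n, hn⟩ := ih
    obtain ⟨n', hn'⟩ := hk n
    refine ⟨n' + 1, fun α _ f V hV => ?_⟩
    have hne : V.Nonempty := Finset.card_pos.mp (by omega)
    -- All edges through the least vertex get one colour after passing to `W`; the rest of the set
    -- is built inside `W`.
    set v := V.min' hne with hv
    have hvV : v ∈ V := V.min'_mem hne
    obtain ⟨W, hWV, hW, c, hc⟩ := hn' α (fun e => f (insert v e)) (V.erase v)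
      (by rw [Finset.card_erase_of_mem hvV]; omega)
    obtain ⟨S, hSW, hS, hSf⟩ := hn α f W hW.ge
    have hlt : ∀ x ∈ S, v < x := fun x hx => V.min'_lt_of_mem_erase_min' hne (hWV (hSW hx))
    have hvS : v ∉ S := fun h => lt_irrefl _ (hlt v h)
    refine ⟨insert v S, ?_, by rw [Finset.card_insert_of_notMem hvS, hS], ?_⟩
    · intro x hx
      rcases Finset.mem_insert.mp hx with rfl | hx
      · exact hvV
      · exact Finset.mem_of_mem_erase (hWV (hSW hx))
    · have hsub : ∀ w, v ≤ w → ∀ e ⊆ insert v S, (∀ x ∈ e, w < x) → e ⊆ S := by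
        intro w hw e he hlt' x hx
        rcases Finset.mem_insert.mp (he hx) with rfl | hx'
        · exact absurd (hlt' _ hx) (not_lt.mpr hw)
        · exact hx'
      intro w hw
      rcases Finset.mem_insert.mp hw with rfl | hw
      · exact ⟨c, fun e he hek hlt' => hc e ((hsub _ le_rfl e he hlt').trans hSW) hek⟩
      · obtain ⟨d, hd⟩ := hSf w hw
        exact ⟨d, fun e he hek hlt' => hd e (hsub w (hlt w hw).le e he hlt') hek hlt'⟩

/-- The Ramsey theorem for uniform hypergraphs and finitely many colours. -/
theorem exists_homogeneous_finset {κ : Type} [Fintype κ] [Nonempty κ] (k m : ℕ) :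
    ∃ n : ℕ, ∀ (α : Type) [LinearOrder α] (f : Finset α → κ) (V : Finset α),
      n ≤ V.card → ∃ S ⊆ V, S.card = m ∧ ∃ c, ∀ e ⊆ S, e.card = k → f e = c := by
  classical
  induction k generalizing m with
  | zero =>
    refine ⟨m, fun α _ f V hV => ?_⟩
    obtain ⟨S, hSV, hS⟩ := Finset.exists_subset_card_eq hV
    exact ⟨S, hSV, hS, f ∅, fun e _ he => by rw [Finset.card_eq_zero.mp he]⟩
  | succ k ih =>
    obtain ⟨n, hn⟩ := exists_minHomogeneous_of_ramsey ih (Fintype.card κ * m)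
    refine ⟨n, fun α _ f V hV => ?_⟩
    obtain ⟨S, hSV, hS, hSf⟩ := hn α f V hV
    choose! g hg using hSf
    -- Pigeonhole on the colours attached to least vertices.
    obtain ⟨c, -, hc⟩ := Finset.exists_le_card_fiber_of_mul_le_card_of_maps_to
      (s := S) (t := Finset.univ) (f := g) (n := m) (fun _ _ => Finset.mem_univ _)
      Finset.univ_nonempty (by rw [hS, Finset.card_univ])
    obtain ⟨T, hT, hTm⟩ := Finset.exists_subset_card_eq hc
    refine ⟨T, hT.trans ((Finset.filter_subset _ _).trans hSV), hTm, c, fun e he hek => ?_⟩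
    have hne : e.Nonempty := Finset.card_pos.mp (by omega)
    have hv := Finset.mem_filter.mp (hT (he (e.min'_mem hne)))
    rw [← hv.2, ← hg _ hv.1 (e.erase (e.min' hne)), Finset.insert_erase (e.min'_mem hne)]
    · exact fun x hx => (Finset.mem_filter.mp (hT (he (Finset.mem_of_mem_erase hx)))).1
    · rw [Finset.card_erase_of_mem (e.min'_mem hne), hek]; rfl
    · exact fun x hx => e.min'_lt_of_mem_erase_min' hne hx

/-! ### Random graphs -/

section Counting

variable {α : Type*} [Fintype α] [DecidableEq α]

/-- Labels of distinct sets are chosen independently. Every finite set is labelled, though only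
pairs matter; the product form avoids division. -/
theorem card_forall_edge_mem_mul {q : ℕ} (A : Finset (Fin q)) (T : Finset α) :
    (Finset.univ.filter fun f : Finset α → Fin q => ∀ e ∈ T.powersetCard 2, f e ∈ A).card *
        q ^ T.card.choose 2 = A.card ^ T.card.choose 2 * q ^ Fintype.card (Finset α) := by
  have h : (Finset.univ.filter fun f : Finset α → Fin q => ∀ e ∈ T.powersetCard 2, f e ∈ A) =
      Fintype.piFinset fun e => if e ∈ T.powersetCard 2 then A else Finset.univ := by
    ext f
    simp only [Finset.mem_filter, Finset.mem_univ, true_and, Fintype.mem_piFinset]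
    refine forall_congr' fun e => ?_
    split_ifs with he <;> simp [he]
  rw [h, Fintype.card_piFinset]
  have h2 : ∀ e : Finset α, (if e ∈ T.powersetCard 2 then A else Finset.univ).card =
      if e ∈ T.powersetCard 2 then A.card else q := by
    intro e; split_ifs <;> simp
  simp_rw [h2]
  rw [Finset.prod_ite, Finset.prod_const, Finset.prod_const, Finset.filter_mem_eq_inter,
    Finset.univ_inter, Finset.card_powersetCard, mul_assoc, ← pow_add,
    ← Finset.card_univ, ← Finset.card_filter_add_card_filter_not (s := Finset.univ)
      (fun e => e ∈ T.powersetCard 2), Finset.filter_mem_eq_inter, Finset.univ_inter,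
    Finset.card_powersetCard, add_comm]

/-- The edge labellings in which some clique of size `s` is labelled within `A`. -/
def labellingsWithClique (α : Type*) [Fintype α] [DecidableEq α] {q : ℕ} (A : Finset (Fin q))
    (s : ℕ) : Finset (Finset α → Fin q) :=
  (Finset.univ.powersetCard s).biUnion fun T =>
    Finset.univ.filter fun f => ∀ e ∈ T.powersetCard 2, f e ∈ A

theorem card_labellingsWithClique_mul_le {q : ℕ} (A : Finset (Fin q)) (s : ℕ) :
    (labellingsWithClique α A s).card * q ^ s.choose 2 ≤
      Fintype.card α ^ s * A.card ^ s.choose 2 * q ^ Fintype.card (Finset α) := by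
  calc _ ≤ (∑ T ∈ Finset.univ.powersetCard s, (Finset.univ.filter
        fun f : Finset α → Fin q => ∀ e ∈ T.powersetCard 2, f e ∈ A).card) * q ^ s.choose 2 :=
        Nat.mul_le_mul_right _ Finset.card_biUnion_le
    _ = ∑ T ∈ (Finset.univ : Finset α).powersetCard s,
          A.card ^ s.choose 2 * q ^ Fintype.card (Finset α) := by
        rw [Finset.sum_mul]
        refine Finset.sum_congr rfl fun T hT => ?_
        rw [← (Finset.mem_powersetCard.mp hT).2, card_forall_edge_mem_mul]
    _ ≤ _ := by
        rw [Finset.sum_const, Finset.card_powersetCard, smul_eq_mul, Finset.card_univ, mul_assoc]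
        exact Nat.mul_le_mul_right _ (Nat.choose_le_pow _ _)

/-- The union bound for the existence of an edge labelling with no clique of size `s` labelled
within `A` and no clique of size `n` labelled within `B`. -/
theorem exists_labelling_of_union_bound {q s n : ℕ} (hq : 0 < q) (A B : Finset (Fin q))
    (hA : 2 * (Fintype.card α ^ s * A.card ^ s.choose 2) < q ^ s.choose 2)
    (hB : 2 * (Fintype.card α ^ n * B.card ^ n.choose 2) < q ^ n.choose 2) :
    ∃ f : Finset α → Fin q, (∀ T : Finset α, T.card = s → ∃ e ∈ T.powersetCard 2, f e ∉ A) ∧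
      ∀ T : Finset α, T.card = n → ∃ e ∈ T.powersetCard 2, f e ∉ B := by
  have key : ∀ (r : ℕ) (C : Finset (Fin q)),
      2 * (Fintype.card α ^ r * C.card ^ r.choose 2) < q ^ r.choose 2 →
      2 * (labellingsWithClique α C r).card < q ^ Fintype.card (Finset α) := by
    intro r C h
    have h0 : 0 < q ^ Fintype.card (Finset α) := pow_pos hq _
    have := card_labellingsWithClique_mul_le (α := α) C r
    by_contra! hcon
    have h1 := Nat.mul_le_mul_right (q ^ r.choose 2) hcon
    have h2 := Nat.mul_lt_mul_of_pos_right h h0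
    nlinarith
  have h1 := key s A hA
  have h2 := key n B hB
  have hex : ∃ f, f ∉ labellingsWithClique α A s ∪ labellingsWithClique α B n := by
    by_contra! hcon
    have h3 := Finset.card_union_le (labellingsWithClique α A s) (labellingsWithClique α B n)
    rw [Finset.eq_univ_of_forall hcon, Finset.card_univ, Fintype.card_fun, Fintype.card_fin] at h3
    omega
  obtain ⟨f, hf⟩ := hex
  simp only [labellingsWithClique, Finset.mem_union, Finset.mem_biUnion, Finset.mem_filter,
    Finset.mem_powersetCard, Finset.mem_univ, true_and, Finset.subset_univ, not_or, not_exists,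
    not_and, not_forall, exists_prop] at hf
  exact ⟨f, by simpa only [Finset.mem_powersetCard] using hf⟩

end Counting

/-! ### Numerical estimates for the union bounds -/

theorem pow_add_mul_pow_le_succ_pow (p n : ℕ) :
    p ^ (n + 1) + (n + 1) * p ^ n ≤ (p + 1) ^ (n + 1) := by
  induction n with
  | zero => simp
  | succ n ih =>
    have h := Nat.mul_le_mul_right (p + 1) ih
    rw [pow_succ (p + 1) (n + 1)]
    refine le_trans ?_ h
    ring_nf
    omega

/-- Bernoulli: p + 1 independent pairs all avoid a label of probability 1/(p + 1) with probability
at most 1/2. -/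
theorem two_mul_pow_succ_le_succ_pow_succ (p : ℕ) : 2 * p ^ (p + 1) ≤ (p + 1) ^ (p + 1) := by
  have h := pow_add_mul_pow_le_succ_pow p p
  rw [pow_succ] at h ⊢
  nlinarith [Nat.zero_le (p ^ p)]

/-- The exponents of 2 to compare are 4t^3 + 1 and 8t^3 - 2t^2. -/
theorem union_bound_small_clique {t : ℕ} (ht : 1 ≤ t) :
    2 * ((2 ^ t ^ 2) ^ (4 * t) * 1 ^ (4 * t).choose 2) < (2 ^ t) ^ (4 * t).choose 2 := by
  have hc : (4 * t).choose 2 = 2 * t * (4 * t - 1) := by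
    rw [Nat.choose_two_right, show 4 * t * (4 * t - 1) = 2 * t * (4 * t - 1) * 2 by ring,
      Nat.mul_div_cancel _ two_pos]
  rw [hc, one_pow, mul_one, ← pow_mul, ← pow_mul, ← pow_succ']
  refine Nat.pow_lt_pow_right one_lt_two ?_
  obtain ⟨u, rfl⟩ := Nat.exists_eq_add_of_le' ht
  rw [show 4 * (u + 1) - 1 = 4 * u + 3 by omega]
  ring_nf
  nlinarith [Nat.zero_le (u ^ 3), Nat.zero_le (u ^ 2)]

/-- With p + 1 = 2^t and n = 2^(3t), the pairs split into M = 4^t (n - 1)/2 blocks of size p + 1,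
each costing a factor of at most 1/2. It remains that M exceeds t^2 n + 1. -/
theorem union_bound_large_clique {t : ℕ} (ht : 1 ≤ t) :
    2 * ((2 ^ t ^ 2) ^ 2 ^ (3 * t) * (2 ^ t - 1) ^ (2 ^ (3 * t)).choose 2) <
      (2 ^ t) ^ (2 ^ (3 * t)).choose 2 := by
  obtain ⟨u, rfl⟩ := Nat.exists_eq_add_of_le' ht
  obtain ⟨p, hp⟩ := Nat.exists_eq_add_of_le' (Nat.one_le_two_pow (n := u + 1))
  have hp0 : 0 < p := by
    have : 2 ^ 1 ≤ 2 ^ (u + 1) := Nat.pow_le_pow_right two_pos (by omega)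
    omega
  set n := 2 ^ (3 * (u + 1)) with hn
  have hn8 : n = 2 * ((p + 1) * (2 * 4 ^ u)) := by
    rw [← hp, hn, show (4 : ℕ) = 2 ^ 2 by rfl, ← pow_mul, ← pow_succ', ← pow_add, ← pow_succ']
    congr 1; ring
  have hn8' : 8 ≤ n := by
    calc 8 = 2 ^ (3 * 1) := rfl
      _ ≤ n := Nat.pow_le_pow_right two_pos (by omega)
  set M := 2 * 4 ^ u * (n - 1) with hM
  have hc : n.choose 2 = (p + 1) * M := by
    rw [Nat.choose_two_right, hM]
    nth_rewrite 1 [hn8]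
    rw [show 2 * ((p + 1) * (2 * 4 ^ u)) * (n - 1) = (p + 1) * (2 * 4 ^ u * (n - 1)) * 2 by ring,
      Nat.mul_div_cancel _ two_pos]
  have hlt : 1 + (u + 1) ^ 2 * n < M := by
    have h1 : (u + 1) ^ 2 ≤ 4 ^ u := by
      rw [show (4 : ℕ) = 2 ^ 2 by rfl, ← pow_mul, mul_comm 2 u, pow_mul]
      exact Nat.pow_le_pow_left Nat.lt_two_pow_self 2
    have h2 : 1 ≤ 4 ^ u := Nat.one_le_pow _ _ (by norm_num)
    obtain ⟨k, hk⟩ := Nat.exists_eq_add_of_le' hn8'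
    have h3 := Nat.mul_le_mul_right n h1
    rw [hM, hk, show k + 8 - 1 = k + 7 by omega]
    rw [hk] at h3
    nlinarith [Nat.zero_le (4 ^ u * k)]
  rw [hc, hp, Nat.add_sub_cancel, pow_mul _ (p + 1) M, pow_mul _ (p + 1) M, ← pow_mul, ← mul_assoc,
    ← pow_succ']
  calc 2 ^ ((u + 1) ^ 2 * n + 1) * (p ^ (p + 1)) ^ M < 2 ^ M * (p ^ (p + 1)) ^ M :=
        Nat.mul_lt_mul_of_pos_right (Nat.pow_lt_pow_right one_lt_two (by omega)) (by positivity)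
    _ = (2 * p ^ (p + 1)) ^ M := (mul_pow _ _ _).symm
    _ ≤ _ := Nat.pow_le_pow_left (two_mul_pow_succ_le_succ_pow_succ p) M

/-- A relation on `{0, …, N - 1}` in which neither it nor its complement has large cliques. -/
theorem exists_unbalanced_ramsey_relation {t : ℕ} (ht : 1 ≤ t) :
    ∃ R : ℕ → ℕ → Prop, (∀ i j, R i j → R j i) ∧
      (∀ T ⊆ Finset.range (2 ^ t ^ 2), 4 * t ≤ T.card → ∃ i ∈ T, ∃ j ∈ T, i ≠ j ∧ R i j) ∧
      ∀ T ⊆ Finset.range (2 ^ t ^ 2), 2 ^ (3 * t) ≤ T.card →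
        ∃ i ∈ T, ∃ j ∈ T, i ≠ j ∧ ¬ R i j := by
  set N := 2 ^ t ^ 2
  have hq : 0 < 2 ^ t := by positivity
  -- One of the 2^t labels marks the non-edges, so plain counting realises the density 2^(-t).
  let z : Fin (2 ^ t) := ⟨0, hq⟩
  obtain ⟨f, hf1, hf2⟩ := exists_labelling_of_union_bound (α := Fin N) hq {z} {z}ᶜ
    (by simpa using union_bound_small_clique ht)
    (by simpa [Finset.card_compl] using union_bound_large_clique ht)
  let R : ℕ → ℕ → Prop := fun i j => f {x : Fin N | (x : ℕ) = i ∨ (x : ℕ) = j} ≠ z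
  have hR : ∀ a b : Fin N, R a b ↔ f {a, b} ≠ z := by
    intro a b
    have : ({x : Fin N | (x : ℕ) = a ∨ (x : ℕ) = b} : Finset (Fin N)) = {a, b} := by
      ext x; simp [Fin.ext_iff]
    simp only [R, this]
  have key : ∀ (A : Finset (Fin (2 ^ t))) (s : ℕ),
      (∀ T : Finset (Fin N), T.card = s → ∃ e ∈ T.powersetCard 2, f e ∉ A) →
      ∀ T ⊆ Finset.range N, s ≤ T.card →
        ∃ a b : Fin N, (a : ℕ) ∈ T ∧ (b : ℕ) ∈ T ∧ (a : ℕ) ≠ b ∧ f {a, b} ∉ A := by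
    intro A s h T hT hs
    have hcard : (T.attachFin fun i hi => Finset.mem_range.mp (hT hi)).card = T.card :=
      Finset.card_attachFin _ _
    obtain ⟨T', hT', hs'⟩ := Finset.exists_subset_card_eq (hs.trans hcard.ge)
    obtain ⟨e, he, hA⟩ := h T' hs'
    obtain ⟨heT, he2⟩ := Finset.mem_powersetCard.mp he
    obtain ⟨a, b, hab, rfl⟩ := Finset.card_eq_two.mp he2
    exact ⟨a, b, Finset.mem_attachFin _ |>.mp (hT' (heT (by simp))),
      Finset.mem_attachFin _ |>.mp (hT' (heT (by simp))), fun h => hab (Fin.ext h), hA⟩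
  refine ⟨R, fun i j h => ?_, fun T hT hs => ?_, fun T hT hs => ?_⟩
  · simpa only [R, or_comm] using h
  · obtain ⟨a, b, ha, hb, hab, h⟩ := key _ _ hf1 T hT hs
    exact ⟨a, ha, b, hb, hab, (hR a b).mpr (by simpa using h)⟩
  · obtain ⟨a, b, ha, hb, hab, h⟩ := key _ _ hf2 T hT hs
    exact ⟨a, ha, b, hb, hab, fun h' => (hR a b).mp h' (by simpa using h)⟩

/-! ### The highest differing binary digit -/

/-- The position of the highest binary digit in which `x` and `y` differ (and `0` if `x = y`). -/
noncomputable def topDiffBit (x y : ℕ) : ℕ := sInf {k | x / 2 ^ (k + 1) = y / 2 ^ (k + 1)}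

theorem div_two_pow_eq_of_le {x y k m : ℕ} (hkm : k ≤ m) (h : x / 2 ^ k = y / 2 ^ k) :
    x / 2 ^ m = y / 2 ^ m := by
  obtain ⟨d, rfl⟩ := Nat.exists_eq_add_of_le hkm
  rw [pow_add, ← Nat.div_div_eq_div_mul, ← Nat.div_div_eq_div_mul, h]

theorem topDiffBit_spec (x y : ℕ) :
    x / 2 ^ (topDiffBit x y + 1) = y / 2 ^ (topDiffBit x y + 1) := by
  refine Nat.sInf_mem (s := {k | x / 2 ^ (k + 1) = y / 2 ^ (k + 1)}) ⟨x + y, ?_⟩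
  have h : x + y < 2 ^ (x + y + 1) :=
    Nat.lt_two_pow_self.trans (Nat.pow_lt_pow_right one_lt_two (Nat.lt_succ_self _))
  rw [Set.mem_ofPred_eq, Nat.div_eq_of_lt (by omega), Nat.div_eq_of_lt (by omega)]

theorem topDiffBit_le_iff {x y k : ℕ} :
    topDiffBit x y ≤ k ↔ x / 2 ^ (k + 1) = y / 2 ^ (k + 1) :=
  ⟨fun h => div_two_pow_eq_of_le (Nat.succ_le_succ h) (topDiffBit_spec x y),
    fun h => Nat.sInf_le h⟩

theorem div_two_pow_topDiffBit_ne {x y : ℕ} (hxy : x ≠ y) :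
    x / 2 ^ topDiffBit x y ≠ y / 2 ^ topDiffBit x y := by
  intro h
  rcases hk : topDiffBit x y with _ | k
  · rw [hk] at h
    simp at h
    exact hxy h
  · rw [hk, ← topDiffBit_le_iff, hk] at h
    omega

theorem topDiffBit_lt_iff {x y k : ℕ} (hxy : x ≠ y) :
    topDiffBit x y < k ↔ x / 2 ^ k = y / 2 ^ k :=
  ⟨fun h => div_two_pow_eq_of_le h (topDiffBit_spec x y), fun h => by
    by_contra! hk
    exact div_two_pow_topDiffBit_ne hxy (div_two_pow_eq_of_le hk h)⟩

theorem topDiffBit_lt_of_lt_two_pow {x y N : ℕ} (hxy : x ≠ y) (hx : x < 2 ^ N) (hy : y < 2 ^ N) :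
    topDiffBit x y < N := by
  rw [topDiffBit_lt_iff hxy, Nat.div_eq_of_lt hx, Nat.div_eq_of_lt hy]

/-- Quotients by a power of 2 are monotone, so the outer two agree iff both neighbouring pairs do.
-/
theorem topDiffBit_eq_max {x y z : ℕ} (hxy : x ≤ y) (hyz : y ≤ z) :
    topDiffBit x z = max (topDiffBit x y) (topDiffBit y z) := by
  refine eq_of_forall_ge_iff fun k => ?_
  rw [max_le_iff, topDiffBit_le_iff, topDiffBit_le_iff, topDiffBit_le_iff]
  have h1 := Nat.div_le_div_right (c := 2 ^ (k + 1)) hxy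
  have h2 := Nat.div_le_div_right (c := 2 ^ (k + 1)) hyz
  omega

/-- At a common top bit, x < y forces the digit 1 in y, while y < z forces the digit 0. -/
theorem topDiffBit_ne {x y z : ℕ} (hxy : x < y) (hyz : y < z) :
    topDiffBit x y ≠ topDiffBit y z := by
  intro h
  have h1 := div_two_pow_topDiffBit_ne hxy.ne
  have h2 := div_two_pow_topDiffBit_ne hyz.ne
  have h3 := topDiffBit_spec x y
  have h4 := topDiffBit_spec y z
  rw [← h] at h2 h4
  rw [pow_succ, ← Nat.div_div_eq_div_mul, ← Nat.div_div_eq_div_mul] at h3 h4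
  have h5 := Nat.div_le_div_right (c := 2 ^ topDiffBit x y) hxy.le
  have h6 := Nat.div_le_div_right (c := 2 ^ topDiffBit x y) hyz.le
  omega

/-- The pair of levels `i`, `j` is seen by some triple of elements of `S`. -/
def IsSplitPair (S : Finset ℕ) (i j : ℕ) : Prop :=
  ∃ x ∈ S, ∃ y ∈ S, ∃ z ∈ S, x < y ∧ y < z ∧
    (topDiffBit x y = i ∧ topDiffBit y z = j ∨ topDiffBit x y = j ∧ topDiffBit y z = i)

theorem IsSplitPair.symm {S : Finset ℕ} {i j : ℕ} (h : IsSplitPair S i j) : IsSplitPair S j i := by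
  obtain ⟨x, hx, y, hy, z, hz, hxy, hyz, h⟩ := h
  exact ⟨x, hx, y, hy, z, hz, hxy, hyz, h.symm⟩

theorem IsSplitPair.mono {S S' : Finset ℕ} (hS : S ⊆ S') {i j : ℕ} (h : IsSplitPair S i j) :
    IsSplitPair S' i j := by
  obtain ⟨x, hx, y, hy, z, hz, h⟩ := h
  exact ⟨x, hS hx, y, hS hy, z, hS hz, h⟩

/-- In the binary tree spanned by `2 ^ s` numbers there is a branch with `s` branching levels. -/
theorem exists_branch {s : ℕ} : ∀ {S : Finset ℕ}, 2 ^ s ≤ S.card → ∃ T : Finset ℕ, T.card = s ∧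
    (∀ i ∈ T, ∃ x ∈ S, ∃ y ∈ S, x < y ∧ topDiffBit x y = i) ∧
    ∀ i ∈ T, ∀ j ∈ T, i ≠ j → IsSplitPair S i j := by
  induction s with
  | zero => exact fun _ => ⟨∅, by simp⟩
  | succ s ih =>
    intro S hS
    have h1 : 1 < S.card := by
      have := Nat.one_le_two_pow (n := s)
      rw [pow_succ] at hS; omega
    have hne : S.Nonempty := Finset.card_pos.mp (by omega)
    set a := S.min' hne
    set b := S.max' hne
    have ha : a ∈ S := S.min'_mem hne
    have hb : b ∈ S := S.max'_mem hne
    have hab : a < b := S.min'_lt_max'_of_card h1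
    set k := topDiffBit a b with hk
    -- All elements share the digits above `k`, so digit `k` splits `S` into the halves of `a` and
    -- `b`.
    have hsplit : ∀ x ∈ S, x / 2 ^ k = a / 2 ^ k ∨ x / 2 ^ k = b / 2 ^ k := by
      intro x hx
      have h3 := topDiffBit_spec a b
      rw [← hk, pow_succ, ← Nat.div_div_eq_div_mul, ← Nat.div_div_eq_div_mul] at h3
      have h5 : a / 2 ^ k ≤ x / 2 ^ k := Nat.div_le_div_right (S.min'_le x hx)
      have h6 : x / 2 ^ k ≤ b / 2 ^ k := Nat.div_le_div_right (S.le_max' x hx)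
      omega
    have hne' : a / 2 ^ k ≠ b / 2 ^ k := div_two_pow_topDiffBit_ne hab.ne
    -- Recurse into a half with at least `2 ^ s` elements and add `k` above its levels.
    have descend : ∀ (A : Finset ℕ) (c : ℕ), A ⊆ S → (∀ x ∈ A, x / 2 ^ k = c) → 2 ^ s ≤ A.card →
        (c = a / 2 ^ k ∨ c = b / 2 ^ k) → ∃ T : Finset ℕ, T.card = s + 1 ∧
        (∀ i ∈ T, ∃ x ∈ S, ∃ y ∈ S, x < y ∧ topDiffBit x y = i) ∧
        ∀ i ∈ T, ∀ j ∈ T, i ≠ j → IsSplitPair S i j := by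
      intro A c hA hc hAs hcab
      obtain ⟨T, hT, hT1, hT2⟩ := ih hAs
      have hlt : ∀ i ∈ T, i < k := by
        intro i hi
        obtain ⟨x, hx, y, hy, hxy, rfl⟩ := hT1 i hi
        rw [topDiffBit_lt_iff hxy.ne, hc x hx, hc y hy]
      have hpair : ∀ i ∈ T, IsSplitPair S i k := by
        intro i hi
        obtain ⟨x, hx, y, hy, hxy, h⟩ := hT1 i hi
        have hik := hlt i hi
        rcases hcab with rfl | rfl
        -- The extreme element of the other half is the third point: `b` after `y` here, `a` before
        -- `x` in the mirror case.
        · have hyb : y ≠ b := by rintro rfl; exact hne' (hc _ hy).symm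
          have hyb' : y < b := lt_of_le_of_ne (S.le_max' y (hA hy)) hyb
          refine ⟨x, hA hx, y, hA hy, b, hb, hxy, hyb', Or.inl ⟨h, le_antisymm ?_ ?_⟩⟩
          · have := topDiffBit_eq_max (S.min'_le y (hA hy)) hyb'.le
            exact (le_max_right _ _).trans this.ge
          · by_contra! h'
            rw [topDiffBit_lt_iff hyb, hc y hy] at h'
            exact hne' h'
        · have hxa : a ≠ x := by intro h; subst h; exact hne' (hc _ hx)
          have hxa' : a < x := lt_of_le_of_ne (S.min'_le x (hA hx)) hxa
          refine ⟨a, ha, x, hA hx, y, hA hy, hxa', hxy, Or.inr ⟨le_antisymm ?_ ?_, h⟩⟩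
          · have := topDiffBit_eq_max hxa'.le (S.le_max' x (hA hx))
            exact (le_max_left _ _).trans this.ge
          · by_contra! h'
            rw [topDiffBit_lt_iff hxa, hc x hx] at h'
            exact hne' h'
      refine ⟨insert k T, ?_, ?_, ?_⟩
      · rw [Finset.card_insert_of_notMem fun h => lt_irrefl _ (hlt k h), hT]
      · intro i hi
        rcases Finset.mem_insert.mp hi with rfl | hi
        · exact ⟨a, ha, b, hb, hab, rfl⟩
        · obtain ⟨x, hx, y, hy, h⟩ := hT1 i hi
          exact ⟨x, hA hx, y, hA hy, h⟩
      · intro i hi j hj hij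
        rcases Finset.mem_insert.mp hi with rfl | hi' <;>
          rcases Finset.mem_insert.mp hj with rfl | hj'
        · exact absurd rfl hij
        · exact (hpair j hj').symm
        · exact hpair i hi'
        · exact (hT2 i hi' j hj' hij).mono hA
    have hcard := Finset.card_filter_add_card_filter_not (s := S) (fun x => x / 2 ^ k = a / 2 ^ k)
    rw [pow_succ] at hS
    by_cases hbig : 2 ^ s ≤ (S.filter fun x => x / 2 ^ k = a / 2 ^ k).card
    · exact descend _ _ (Finset.filter_subset _ _) (fun x hx => (Finset.mem_filter.mp hx).2) hbig
        (Or.inl rfl)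
    · refine descend (S.filter fun x => ¬ x / 2 ^ k = a / 2 ^ k) _ (Finset.filter_subset _ _)
        (fun x hx => ?_) (by omega) (Or.inr rfl)
      obtain ⟨hxS, hx⟩ := Finset.mem_filter.mp hx
      exact (hsplit x hxS).resolve_left hx

/-- If the levels increase along `S`, they form a clique of any relation holding on consecutive
levels of triples. -/
theorem exists_clique_of_increasing {S : Finset ℕ} {R : ℕ → ℕ → Prop} (hsymm : ∀ i j, R i j → R j i)
    (hS : S.Nonempty)
    (h : ∀ x ∈ S, ∀ y ∈ S, ∀ z ∈ S, x < y → y < z →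
      topDiffBit x y < topDiffBit y z ∧ R (topDiffBit x y) (topDiffBit y z)) :
    ∃ T : Finset ℕ, T.card = S.card - 1 ∧
      (∀ i ∈ T, ∃ x ∈ S, ∃ y ∈ S, x < y ∧ topDiffBit x y = i) ∧
      ∀ i ∈ T, ∀ j ∈ T, i ≠ j → R i j := by
  set a := S.min' hS
  have ha : a ∈ S := S.min'_mem hS
  -- Levels are measured from the minimum: as they increase, `topDiffBit a z` equals `topDiffBit y
  -- z`.
  have key : ∀ y ∈ S.erase a, ∀ z ∈ S.erase a, y < z →
      topDiffBit a y < topDiffBit a z ∧ R (topDiffBit a y) (topDiffBit a z) := by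
    intro y hy z hz hyz
    have hay := S.min'_lt_of_mem_erase_min' hS hy
    have := h a ha y (Finset.mem_of_mem_erase hy) z (Finset.mem_of_mem_erase hz) hay hyz
    rwa [topDiffBit_eq_max hay.le hyz.le, max_eq_right this.1.le]
  refine ⟨(S.erase a).image (topDiffBit a), ?_, ?_, ?_⟩
  · rw [Finset.card_image_of_injOn, Finset.card_erase_of_mem ha]
    exact StrictMonoOn.injOn fun y hy z hz hyz => (key y hy z hz hyz).1
  · intro i hi
    obtain ⟨y, hy, rfl⟩ := Finset.mem_image.mp hi
    exact ⟨a, ha, y, Finset.mem_of_mem_erase hy, S.min'_lt_of_mem_erase_min' hS hy, rfl⟩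
  · intro i hi j hj hij
    obtain ⟨y, hy, rfl⟩ := Finset.mem_image.mp hi
    obtain ⟨z, hz, rfl⟩ := Finset.mem_image.mp hj
    rcases lt_trichotomy y z with hyz | rfl | hyz
    · exact (key y hy z hz hyz).2
    · exact absurd rfl hij
    · exact hsymm _ _ (key z hz y hy hyz).2

/-- If the levels decrease along `S`, they form a clique of any relation holding on consecutive
levels of triples. -/
theorem exists_clique_of_decreasing {S : Finset ℕ} {R : ℕ → ℕ → Prop} (hsymm : ∀ i j, R i j → R j i)
    (hS : S.Nonempty)
    (h : ∀ x ∈ S, ∀ y ∈ S, ∀ z ∈ S, x < y → y < z →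
      topDiffBit y z < topDiffBit x y ∧ R (topDiffBit x y) (topDiffBit y z)) :
    ∃ T : Finset ℕ, T.card = S.card - 1 ∧
      (∀ i ∈ T, ∃ x ∈ S, ∃ y ∈ S, x < y ∧ topDiffBit x y = i) ∧
      ∀ i ∈ T, ∀ j ∈ T, i ≠ j → R i j := by
  set b := S.max' hS
  have hb : b ∈ S := S.max'_mem hS
  -- Mirror image: levels are measured from the maximum.
  have key : ∀ y ∈ S.erase b, ∀ z ∈ S.erase b, y < z →
      topDiffBit z b < topDiffBit y b ∧ R (topDiffBit y b) (topDiffBit z b) := by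
    intro y hy z hz hyz
    have hzb := S.lt_max'_of_mem_erase_max' hS hz
    have := h y (Finset.mem_of_mem_erase hy) z (Finset.mem_of_mem_erase hz) b hb hyz hzb
    rwa [topDiffBit_eq_max hyz.le hzb.le, max_eq_left this.1.le]
  refine ⟨(S.erase b).image fun y => topDiffBit y b, ?_, ?_, ?_⟩
  · rw [Finset.card_image_of_injOn, Finset.card_erase_of_mem hb]
    exact StrictAntiOn.injOn fun y hy z hz hyz => (key y hy z hz hyz).1
  · intro i hi
    obtain ⟨y, hy, rfl⟩ := Finset.mem_image.mp hi
    exact ⟨y, Finset.mem_of_mem_erase hy, b, hb, S.lt_max'_of_mem_erase_max' hS hy, rfl⟩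
  · intro i hi j hj hij
    obtain ⟨y, hy, rfl⟩ := Finset.mem_image.mp hi
    obtain ⟨z, hz, rfl⟩ := Finset.mem_image.mp hj
    rcases lt_trichotomy y z with hyz | rfl | hyz
    · exact (key y hy z hz hyz).2
    · exact absurd rfl hij
    · exact hsymm _ _ (key z hz y hy hyz).2

/-! ### The stepping-up colouring -/

open Classical in
/-- The colouring of triples stepped up from a symmetric relation `R` on levels. -/
noncomputable def stepUpColouring (R : ℕ → ℕ → Prop) (n : ℕ) : EdgeColouring 3 3 n := fun e =>
  let v : Fin 3 → ℕ := fun i => e.1.orderEmbOfFin e.2 i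
  if R (topDiffBit (v 0) (v 1)) (topDiffBit (v 1) (v 2)) then
    if topDiffBit (v 0) (v 1) < topDiffBit (v 1) (v 2) then 0 else 1
  else 2

open Classical in
theorem IsMonochromatic.stepUpColouring_eq {R : ℕ → ℕ → Prop} {n : ℕ} {i : Fin 3}
    {S : Finset (Fin n)} (h : IsMonochromatic (stepUpColouring R n) i S) {x y z : ℕ}
    (hx : x ∈ S.map Fin.valEmbedding) (hy : y ∈ S.map Fin.valEmbedding)
    (hz : z ∈ S.map Fin.valEmbedding) (hxy : x < y) (hyz : y < z) :
    (if R (topDiffBit x y) (topDiffBit y z) then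
      if topDiffBit x y < topDiffBit y z then 0 else 1 else 2) = i := by
  obtain ⟨x, hxS, rfl⟩ := Finset.mem_map.mp hx
  obtain ⟨y, hyS, rfl⟩ := Finset.mem_map.mp hy
  obtain ⟨z, hzS, rfl⟩ := Finset.mem_map.mp hz
  simp only [Fin.valEmbedding_apply, Fin.val_fin_lt] at hxy hyz
  have hcard : ({x, y, z} : Finset (Fin n)).card = 3 :=
    Finset.card_eq_three.mpr ⟨x, y, z, hxy.ne, (hxy.trans hyz).ne, hyz.ne, rfl⟩
  have he := h ⟨{x, y, z}, hcard⟩ (by simp [Finset.insert_subset_iff, hxS, hyS, hzS])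
  have hv : ![x, y, z] = ({x, y, z} : Finset (Fin n)).orderEmbOfFin hcard := by
    refine Finset.orderEmbOfFin_unique hcard (fun i => by fin_cases i <;> simp) ?_
    intro i j hij
    fin_cases i <;> fin_cases j <;> simp_all
    exact hxy.trans hyz
  rw [← he]
  simp only [stepUpColouring, ← hv]
  rfl

/-- Stepping up: from a relation on `N` levels without large cliques and large independent sets to
a colouring of the triples of `n ≤ 2 ^ N` points without large monochromatic sets. -/
theorem two_pow_lt_of_ramseyProperty {R : ℕ → ℕ → Prop} {N s m l n : ℕ}
    (hsymm : ∀ i j, R i j → R j i)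
    (hs : ∀ T ⊆ Finset.range N, s ≤ T.card → ∃ i ∈ T, ∃ j ∈ T, i ≠ j ∧ R i j)
    (hm : ∀ T ⊆ Finset.range N, m ≤ T.card → ∃ i ∈ T, ∃ j ∈ T, i ≠ j ∧ ¬ R i j)
    (hsl : 2 ^ s ≤ l) (hml : m < l) (h : RamseyProperty 3 ![l, l, l] n) : 2 ^ N < n := by
  by_contra! hn
  obtain ⟨i, S, hS, hmono⟩ := h (stepUpColouring R n)
  have hcard : (S.map Fin.valEmbedding).card = l := by
    rw [Finset.card_map, hS]
    fin_cases i <;> rfl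
  have hcol := fun x hx y hy z hz hxy hyz =>
    hmono.stepUpColouring_eq (x := x) (y := y) (z := z) hx hy hz hxy hyz
  have hlt : ∀ x ∈ S.map Fin.valEmbedding, x < 2 ^ N := by
    intro x hx
    obtain ⟨x, -, rfl⟩ := Finset.mem_map.mp hx
    exact x.2.trans_le hn
  clear hmono hS
  generalize S.map Fin.valEmbedding = V at *
  have hV : V.Nonempty := Finset.card_pos.mp (by omega)
  have hrange : ∀ T : Finset ℕ, (∀ i ∈ T, ∃ x ∈ V, ∃ y ∈ V, x < y ∧ topDiffBit x y = i) →
      T ⊆ Finset.range N := by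
    intro T hT i hi
    obtain ⟨x, hx, y, hy, hxy, rfl⟩ := hT i hi
    exact Finset.mem_range.mpr (topDiffBit_lt_of_lt_two_pow hxy.ne (hlt x hx) (hlt y hy))
  match i with
  | 0 =>
    obtain ⟨T, hTc, hT, hTR⟩ := exists_clique_of_increasing hsymm hV (by
      intro x hx y hy z hz hxy hyz
      have := hcol x hx y hy z hz hxy hyz
      split_ifs at this with h1 h2
      · exact ⟨h2, h1⟩
      all_goals simp at this)
    -- The clique has `l - 1` elements, hence the strict inequality `m < l`.
    obtain ⟨i, hi, j, hj, hij, h⟩ := hm T (hrange T hT) (by omega)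
    exact h (hTR i hi j hj hij)
  | 1 =>
    obtain ⟨T, hTc, hT, hTR⟩ := exists_clique_of_decreasing hsymm hV (by
      intro x hx y hy z hz hxy hyz
      have := hcol x hx y hy z hz hxy hyz
      split_ifs at this with h1 h2
      · simp at this
      · exact ⟨lt_of_le_of_ne (not_lt.mp h2) (topDiffBit_ne hxy hyz).symm, h1⟩
      · simp at this)
    obtain ⟨i, hi, j, hj, hij, h⟩ := hm T (hrange T hT) (by omega)
    exact h (hTR i hi j hj hij)
  | 2 =>
    -- Each pair of levels on the branch is seen by a triple of colour 2, so `R` must fail on it.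
    obtain ⟨T, hTc, hT, hTR⟩ := exists_branch (hsl.trans hcard.ge)
    obtain ⟨i, hi, j, hj, hij, h⟩ := hs T (hrange T hT) hTc.ge
    obtain ⟨x, hx, y, hy, z, hz, hxy, hyz, hs⟩ := hTR i hi j hj hij
    have hR : R (topDiffBit x y) (topDiffBit y z) := by
      rcases hs with ⟨rfl, rfl⟩ | ⟨rfl, rfl⟩
      · exact h
      · exact hsymm _ _ h
    have := hcol x hx y hy z hz hxy hyz
    rw [if_pos hR] at this
    split_ifs at this <;> simp at this

/-- The Ramsey number is attained: it has the Ramsey property. -/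
theorem ramseyProperty_ramseyNumber (l : ℕ) :
    RamseyProperty 3 ![l, l, l] (ramseyNumber 3 ![l, l, l]) := by
  refine Nat.sInf_mem (s := {n | RamseyProperty 3 ![l, l, l] n}) ?_
  obtain ⟨n, hn⟩ := exists_homogeneous_finset (κ := Fin 3) 3 l
  refine ⟨n, fun χ => ?_⟩
  obtain ⟨S, -, hS, c, hc⟩ := hn (Fin n) (fun e => if h : e.card = 3 then χ ⟨e, h⟩ else 0)
    Finset.univ (by simp)
  refine ⟨c, S, ?_, fun e he => ?_⟩
  · rw [hS]; fin_cases c <;> rfl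
  · rw [← hc e.1 he e.2, dif_pos e.2]

theorem theorem1 :
    ∃ c : ℝ, 0 < c ∧ ∃ l₀ : ℕ, ∀ l : ℕ, l₀ ≤ l →
      (2 : ℝ) ^ ((l : ℝ) ^ (c * Real.logb 2 (Real.logb 2 (l : ℝ)))) ≤
        (ramseyNumber 3 ![l, l, l] : ℝ) := by
  -- From 16 on, t ≥ 1. Since l < 2^(8t) and the iterated logarithm is at most 8t, the factor 1/64
  -- makes the exponent at most t/8, and l^(t/8) ≤ 2^(t^2).
  refine ⟨1 / 64, by norm_num, 16, fun l hl => ?_⟩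
  have hl0 : l ≠ 0 := by omega
  set t := Nat.log 2 l / 4 with ht_def
  have hlog : 4 ≤ Nat.log 2 l := (Nat.le_log_iff_pow_le one_lt_two hl0).mpr hl
  have ht : 1 ≤ t := by omega
  have hle : 2 ^ (4 * t) ≤ l :=
    (Nat.le_log_iff_pow_le one_lt_two hl0).mp (by omega)
  have hlt : l < 2 ^ (8 * t) :=
    (Nat.lt_pow_succ_log_self one_lt_two l).trans_le (Nat.pow_le_pow_right two_pos (by omega))
  obtain ⟨R, hsymm, hR1, hR2⟩ := exists_unbalanced_ramsey_relation ht
  have hram := two_pow_lt_of_ramseyProperty hsymm hR1 hR2 hle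
    ((Nat.pow_lt_pow_right one_lt_two (by omega)).trans_le hle) (ramseyProperty_ramseyNumber l)
  have hl1 : (1 : ℝ) < l := by exact_mod_cast (by omega : 1 < l)
  have hL0 : 0 < Real.logb 2 l := Real.logb_pos one_lt_two hl1
  have hL : Real.logb 2 l ≤ 8 * t := by
    rw [Real.logb_le_iff_le_rpow one_lt_two (by linarith)]
    exact_mod_cast hlt.le
  -- A lossy step: the construction supports an exponent of order log l in place of log log l.
  have hLL : Real.logb 2 (Real.logb 2 l) ≤ 8 * t := by
    refine le_trans ?_ hL
    rw [Real.logb_le_iff_le_rpow one_lt_two hL0]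
    rw [Real.rpow_logb two_pos (by norm_num) (by linarith)]
    rw [Real.logb_le_iff_le_rpow one_lt_two (by linarith)]
    exact_mod_cast Nat.lt_two_pow_self.le
  have hN : (l : ℝ) ^ (1 / 64 * Real.logb 2 (Real.logb 2 (l : ℝ))) ≤ ((2 ^ t ^ 2 : ℕ) : ℝ) := by
    calc (l : ℝ) ^ (1 / 64 * Real.logb 2 (Real.logb 2 (l : ℝ))) ≤ (l : ℝ) ^ ((t : ℝ) / 8) :=
          Real.rpow_le_rpow_of_exponent_le hl1.le (by linarith)
      _ ≤ ((2 : ℝ) ^ (8 * t : ℝ)) ^ ((t : ℝ) / 8) := by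
          refine Real.rpow_le_rpow (by linarith) ?_ (by positivity)
          exact_mod_cast hlt.le
      _ = ((2 ^ t ^ 2 : ℕ) : ℝ) := by
          rw [← Real.rpow_mul (by norm_num), show (8 * t : ℝ) * (t / 8) = ((t ^ 2 : ℕ) : ℝ) by
            push_cast; ring, Real.rpow_natCast]
          push_cast; rfl
  calc (2 : ℝ) ^ ((l : ℝ) ^ (1 / 64 * Real.logb 2 (Real.logb 2 (l : ℝ))))
      ≤ (2 : ℝ) ^ ((2 ^ t ^ 2 : ℕ) : ℝ) := Real.rpow_le_rpow_of_exponent_le one_le_two hN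
    _ ≤ _ := by
        rw [Real.rpow_natCast]
        exact_mod_cast hram.le
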